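/- **Setting.** Consider a Markov decision process with state space $\mathcal S$, action space $\mathscr A$, transition kernel $P(\cdot\mid s,a)$, immediate reward $r$ distributed according to $\mathcal R(s,a,s')$, and discount factor $\gamma\in(0,1)$. Let $\pi:\mathcal S\to\mathscr A$ be a stationary policy, let $\nu$ be a stationary distribution of the Markov chain induced by $\pi$, and let $\phi:\mathcal S\to\mathbb R^d$ be a feature map. Assume that $\|\phi(s)\|\le 1/2$ for all $s$ and that $|r|\le 1$ for every reward obtained from any $(s,a,s')$. Let $s\sim\nu$, $s'\sim P(\cdot\mid s,\pi(s))$, $r\sim\mathcal R(s,\pi(s),s')$, $\phi=\phi(s)$, $\phi'=\phi(s')$, and put $$A=\mathbb E[\phi(\phi-\gamma\phi')^\top],\qquad b=\mathbb E[r\phi],\qquad \theta^*=A^{-1}b .$$ Let $(\phi_n,\phi_n',r_n)_{n\ge 0}$ be i.i.d. copies of $(\phi,\phi',r)$. For a fixed $\theta_0\in\mathbb R^d$ the TD(0) iterates with stepsizes $\alpha_n=1/(n+1)$ are $$\theta_{n+1}=\theta_n+\alpha_n\,[\,r_n+\gamma\phi_n'^\top\theta_n-\phi_n^\top\theta_n\,]\,\phi_n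 ,\qquad n\ge 0 .$$ **Theorem (TD(0) high-probability convergence rate).** Suppose that $0<\lambda<\min_{i}\operatorname{Re}\lambda_i(A)$, where $\lambda_1(A),\dots,\lambda_d(A)\in\mathbb C$ are the eigenvalues of $A$ (so that $A$ is invertible). Then there are constants $C,K$ and $p\in\mathbb N$, depending only on the problem data (the MDP, $\pi$, $\nu$, $\phi$, $\theta_0$) and on $\lambda$, and a function $N_0:(0,1)\to\mathbb N$ with $N_0(\delta)\le K\ln(1/\delta)$, such that for every $\delta\in(0,1)$ and every integer $n\ge \max\{1,N_0(\delta)\}$, $$\Pr\Big\{\|\theta_n-\theta^*\|\le C\,\big(1+\ln n+\ln\tfrac1\delta\big)^{p}\; n^{-\min\{1/2,\ \lambda/(\lambda+1)\}}\Big\}\ \ge\ 1-\delta ,$$ that is, with probability at least $1-\delta$, $\|\theta_n-\theta^*\|=\tilde O\big(n^{-\min\{1/2,\lambda/(\lambda+1)\}}\big)$, where $\tilde O$ hides problem-dependent constants and poly-logarithmic factors in $n$ and $1/\delta$. -/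

import Mathlib

open MeasureTheory ProbabilityTheory
open scoped Matrix

noncomputable section

/-- A discounted Markov decision process with state space `S` and action space `Act`.
In state `s`, under action `a`, the next state `s'` has law `trans (s, a)`, and the immediate
reward has law `reward (s, a, s')` (a Dirac mass when the reward is a function of `(s, a, s')`). -/
structure MDP (S Act : Type*) [MeasurableSpace S] [MeasurableSpace Act] where
  trans : Kernel (S × Act) S
  trans_markov : IsMarkovKernel trans
  reward : Kernel (S × Act × S) ℝ
  reward_markov : IsMarkovKernel reward
  γ : ℝ
  γ_pos : 0 < γ
  γ_lt_one : γ < 1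

namespace MDP

variable {S Act : Type*} [MeasurableSpace S] [MeasurableSpace Act]

/-- The transition kernel of the Markov chain induced by the stationary policy `pol`. -/
def chain (M : MDP S Act) (pol : S → Act) (hpol : Measurable pol) : Kernel S S :=
  M.trans.comap (fun s => (s, pol s)) (by fun_prop)

/-- The law of the reward given the transition `s → s'` under the policy `pol`. -/
def chainReward (M : MDP S Act) (pol : S → Act) (hpol : Measurable pol) : Kernel (S × S) ℝ :=
  M.reward.comap (fun x => (x.1, pol x.1, x.2)) (by fun_prop)

/-- The joint law of `((s, s'), r)` when `s ∼ ν`, the action is `pol s`, `s'` is the next state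
and `r` is the immediate reward. -/
def transitionLaw (M : MDP S Act) (pol : S → Act) (hpol : Measurable pol) (ν : Measure S) :
    Measure ((S × S) × ℝ) :=
  (ν ⊗ₘ M.chain pol hpol) ⊗ₘ M.chainReward pol hpol

/-- The joint law of `(φ(s), φ(s'), r)` under `MDP.transitionLaw`. -/
def sampleLaw (M : MDP S Act) (pol : S → Act) (hpol : Measurable pol) (ν : Measure S) {d : ℕ}
    (φ : S → EuclideanSpace ℝ (Fin d)) :
    Measure (EuclideanSpace ℝ (Fin d) × EuclideanSpace ℝ (Fin d) × ℝ) :=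
  (M.transitionLaw pol hpol ν).map (fun x => (φ x.1.1, φ x.1.2, x.2))

end MDP

namespace TD

variable {d : ℕ}

/-- `A = 𝔼[φ (φ - γ φ')ᵀ]`, for `(φ, φ', r)` of law `ρ`. -/
def A (γ : ℝ) (ρ : Measure (EuclideanSpace ℝ (Fin d) × EuclideanSpace ℝ (Fin d) × ℝ)) :
    Matrix (Fin d) (Fin d) ℝ :=
  Matrix.of fun i j => ∫ x, x.1 i * (x.1 j - γ * x.2.1 j) ∂ρ

/-- `b = 𝔼[r φ]`, for `(φ, φ', r)` of law `ρ`. -/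
def b (ρ : Measure (EuclideanSpace ℝ (Fin d) × EuclideanSpace ℝ (Fin d) × ℝ)) : Fin d → ℝ :=
  fun i => ∫ x, x.2.2 * x.1 i ∂ρ

/-- The TD(0) solution `θ* = A⁻¹ b`. -/
def solution (γ : ℝ) (ρ : Measure (EuclideanSpace ℝ (Fin d) × EuclideanSpace ℝ (Fin d) × ℝ)) :
    EuclideanSpace ℝ (Fin d) :=
  WithLp.toLp 2 ((A γ ρ)⁻¹ *ᵥ b ρ)

/-- The TD(0) iterates
`θ (n+1) = θ n + α n * (r n + γ * (φ' n)ᵀ θ n - (φ n)ᵀ θ n) * φ n`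
driven by the data `x n = (φ n, φ' n, r n)` with stepsizes `α n`, started at `θ₀`. -/
def iterate (γ : ℝ) (α : ℕ → ℝ) (θ₀ : EuclideanSpace ℝ (Fin d))
    (x : ℕ → EuclideanSpace ℝ (Fin d) × EuclideanSpace ℝ (Fin d) × ℝ) :
    ℕ → EuclideanSpace ℝ (Fin d)
  | 0 => θ₀
  | n + 1 =>
    iterate γ α θ₀ x n +
      (α n * ((x n).2.2 + γ * inner ℝ (x n).2.1 (iterate γ α θ₀ x n)
        - inner ℝ (x n).1 (iterate γ α θ₀ x n))) • (x n).1

end TD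

end

/-!
Let `Δ n = θ n - θ*` and `κ = lam / (lam + 1)`. Since the features are bounded by `1 / 2`, the
matrix `A` contracts by `1 / 2`, so `lam < 1` if `d > 0`, hence `κ < 1 / 2` and `κ ≤ lam`.

*Lyapunov function.* As all eigenvalues of `A` have real part above `lam`, the matrix
`B = 1 - h (A - lam)` has spectral radius below `1` for small `h > 0`, and some power of `B`
contracts by Gelfand's formula. Then `J x = (x, B x, …, B ^ (N - 1) x)` satisfies
`lam ‖J x‖ ^ 2 ≤ ⟪J x, J A x⟫` (`exists_lyapunov_map`).

*Moments.* The potential `U n = 1 + (n + 1) ^ (2 κ) ‖J Δ n‖ ^ 2` changes in one step, with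
`m = n + 1`, by a relative increment of size `O (m ^ (κ - 1))` and of conditional mean at most
`O (m ^ (2 κ - 2))`: the drift `-2 lam / m` pays for the growth of the scaling. So, as long as
`q m ^ (κ - 1)` is small, the `q`-th moment of `U` grows in one step by a factor at most
`exp (O (q ^ 2 m ^ (2 κ - 2)))` (`lintegral_potential_step_le`). Because `2 κ < 1`, the product of
these factors over `m ≥ n₀` is bounded uniformly in `q` once `n₀` is a large power of `q`. Up to
time `n₀` the error grows at most polynomially, whatever the samples, so `U` is at most a power
of `q` there. Altogether the `q`-th moment of `U n` is at most `(C q ^ p) ^ q` for all `n`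
(`TD.lintegral_potential_iterate_le`).

*Tails.* Markov's inequality with `q = ⌈log (1 / δ)⌉` gives `U n ≤ e C q ^ p` with probability at
least `1 - δ`, which is the claim, for every `n ≥ 1`; the burn-in time `N₀` can be taken to be `0`.
-/

/-! ### A Lyapunov function for a matrix with spectrum in a half plane -/

/-- If the eigenvalues of the complex matrix `A` lie in the half plane `lam < re z`, then for
small `h > 0` those of `1 - h (A - lam)` lie in the open unit disc. -/
theorem exists_forall_norm_one_sub_mul_lt_one {d : ℕ} (A : Matrix (Fin d) (Fin d) ℂ) (lam : ℝ)
    (hlam : ∀ z ∈ spectrum ℂ A, lam < z.re) :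
    ∃ h : ℝ, 0 < h ∧ ∀ z ∈ spectrum ℂ A, ‖1 - (h : ℂ) * (z - lam)‖ < 1 := by
  have key : ∀ z ∈ spectrum ℂ A, ∀ᶠ h : ℝ in nhdsWithin 0 (Set.Ioi 0),
      ‖1 - (h : ℂ) * (z - lam)‖ < 1 := by
    intro z hz
    have hpos : 0 < z.re - lam := sub_pos.2 (hlam z hz)
    have hlim : Filter.Tendsto (fun h : ℝ => h * Complex.normSq (z - lam))
        (nhdsWithin 0 (Set.Ioi 0)) (nhds 0) := by
      have : Filter.Tendsto (fun h : ℝ => h * Complex.normSq (z - lam)) (nhds 0)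
          (nhds (0 * Complex.normSq (z - lam))) := (continuous_id.mul continuous_const).tendsto 0
      rw [zero_mul] at this
      exact this.mono_left nhdsWithin_le_nhds
    filter_upwards [hlim.eventually (gt_mem_nhds (by linarith : 0 < 2 * (z.re - lam))),
      self_mem_nhdsWithin] with h h1 h2
    have h2 : 0 < h := h2
    have : ‖1 - (h : ℂ) * (z - lam)‖ ^ 2 < 1 := by
      rw [← Complex.normSq_eq_norm_sq]
      simp only [Complex.normSq_apply, Complex.sub_re, Complex.sub_im, Complex.mul_re,
        Complex.mul_im, Complex.ofReal_re, Complex.ofReal_im, Complex.one_re,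
        Complex.one_im] at h1 ⊢
      nlinarith [mul_lt_mul_of_pos_left h1 h2]
    have h3 := norm_nonneg (1 - (h : ℂ) * (z - lam))
    nlinarith
  have hfin := (Filter.eventually_all_finite (Matrix.finite_spectrum A)).2 key
  obtain ⟨h, h1, h2⟩ := (hfin.and self_mem_nhdsWithin).exists
  exact ⟨h, h2, h1⟩

open scoped Matrix.Norms.Operator in
/-- A complex matrix whose eigenvalues lie in the open unit disc has powers tending to `0`. -/
theorem tendsto_pow_of_forall_spectrum_norm_lt_one {d : ℕ} (B : Matrix (Fin d) (Fin d) ℂ)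
    (hB : ∀ z ∈ spectrum ℂ B, ‖z‖ < 1) :
    Filter.Tendsto (fun n => B ^ n) Filter.atTop (nhds 0) := by
  rcases subsingleton_or_nontrivial (Matrix (Fin d) (Fin d) ℂ) with hs | hs
  · exact tendsto_const_nhds.congr fun n => Subsingleton.elim _ _
  have hr : spectralRadius ℂ B < (1 : NNReal) :=
    spectrum.spectralRadius_lt_of_forall_lt B fun z hz => by exact_mod_cast hB z hz
  obtain ⟨r, hr1, hr2⟩ := ENNReal.lt_iff_exists_nnreal_btwn.1 hr
  have hev := (spectrum.pow_nnnorm_pow_one_div_tendsto_nhds_spectralRadius B).eventually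
    (gt_mem_nhds hr1)
  have hr3 : r < 1 := by exact_mod_cast hr2
  refine squeeze_zero_norm' (a := fun n => (r : ℝ) ^ n) ?_
    (tendsto_pow_atTop_nhds_zero_of_lt_one r.2 hr3)
  filter_upwards [hev, Filter.eventually_gt_atTop 0] with n hn hn0
  have h1 : ((‖B ^ n‖₊ : ENNReal) ^ (1 / n : ℝ)) ^ (n : ℝ) ≤ (r : ENNReal) ^ (n : ℝ) :=
    ENNReal.rpow_le_rpow hn.le (by positivity)
  rw [← ENNReal.rpow_mul, one_div, inv_mul_cancel₀ (by positivity), ENNReal.rpow_one,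
    ENNReal.rpow_natCast] at h1
  exact_mod_cast h1

theorem tendsto_toEuclideanCLM_pow {d : ℕ} (B : Matrix (Fin d) (Fin d) ℝ)
    (hB : ∀ z ∈ spectrum ℂ (B.map (algebraMap ℝ ℂ)), ‖z‖ < 1) :
    Filter.Tendsto (fun n => (Matrix.toEuclideanCLM (n := Fin d) (𝕜 := ℝ) B) ^ n)
      Filter.atTop (nhds 0) := by
  have h1 := tendsto_pow_of_forall_spectrum_norm_lt_one _ hB
  have h2 : Filter.Tendsto (fun n => B ^ n) Filter.atTop (nhds 0) := by
    have h3 : Continuous fun M : Matrix (Fin d) (Fin d) ℂ => M.map Complex.re :=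
      Continuous.matrix_map continuous_id Complex.continuous_re
    have h4 := (h3.tendsto 0).comp h1
    have h5 : (0 : Matrix (Fin d) (Fin d) ℂ).map Complex.re = 0 := by ext; simp
    rw [h5] at h4
    refine h4.congr fun n => ?_
    have : (B.map (algebraMap ℝ ℂ)) ^ n = (B ^ n).map (algebraMap ℝ ℂ) :=
      ((algebraMap ℝ ℂ).mapMatrix.map_pow B n).symm
    ext i j
    rw [Function.comp_apply, this]
    simp
  have h6 : Continuous fun M : Matrix (Fin d) (Fin d) ℝ =>
      Matrix.toEuclideanCLM (n := Fin d) (𝕜 := ℝ) M :=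
    LinearMap.continuous_of_finiteDimensional
      (Matrix.toEuclideanCLM (n := Fin d) (𝕜 := ℝ)).toAlgEquiv.toLinearMap
  have h7 := (h6.tendsto 0).comp h2
  rw [map_zero] at h7
  refine h7.congr fun n => ?_
  simp

/-- The map `x ↦ (x, T x, …, T ^ (N - 1) x)` into the Hilbert sum of `N` copies of the space. -/
noncomputable def orbitMap {E : Type*} [NormedAddCommGroup E] [InnerProductSpace ℝ E]
    (T : E →L[ℝ] E) (N : ℕ) : E →L[ℝ] PiLp 2 (fun _ : Fin N => E) :=
  (PiLp.continuousLinearEquiv 2 ℝ (fun _ : Fin N => E)).symm.toContinuousLinearMap.comp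
    (ContinuousLinearMap.pi fun k : Fin N => T ^ (k : ℕ))

theorem norm_orbitMap_sq {E : Type*} [NormedAddCommGroup E] [InnerProductSpace ℝ E]
    (T : E →L[ℝ] E) (N : ℕ) (x : E) :
    ‖orbitMap T N x‖ ^ 2 = ∑ k ∈ Finset.range N, ‖(T ^ k) x‖ ^ 2 := by
  rw [PiLp.norm_sq_eq_of_L2, Finset.sum_range]
  rfl

/-- A Lyapunov function for `A`, in the form `x ↦ ‖J x‖ ^ 2` with `J` linear. With
`B = 1 - h (A - lam)` and `‖B ^ N‖ ≤ 1`, the sum `∑ k < N, ‖B ^ k x‖ ^ 2` does not increase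
under `B`, which is the stated inequality up to a nonnegative term of order `h`. -/
theorem exists_lyapunov_map {d : ℕ} (A : Matrix (Fin d) (Fin d) ℝ) (lam : ℝ)
    (hlam : ∀ z : ℂ,
      Module.End.HasEigenvalue (Matrix.toLin' (A.map (algebraMap ℝ ℂ))) z → lam < z.re) :
    ∃ (N : ℕ) (J : EuclideanSpace ℝ (Fin d) →L[ℝ]
        PiLp 2 (fun _ : Fin N => EuclideanSpace ℝ (Fin d))),
      (∀ x, ‖x‖ ≤ ‖J x‖) ∧
      ∀ x, lam * ‖J x‖ ^ 2 ≤
        inner ℝ (J x) (J (Matrix.toEuclideanCLM (n := Fin d) (𝕜 := ℝ) A x)) := by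
  have hspec : ∀ z ∈ spectrum ℂ (A.map (algebraMap ℝ ℂ)), lam < z.re := fun z hz =>
    hlam z (Module.End.hasEigenvalue_iff_mem_spectrum.2 (by rwa [Matrix.spectrum_toLin']))
  obtain ⟨h, hpos, hh⟩ := exists_forall_norm_one_sub_mul_lt_one _ lam hspec
  set B : Matrix (Fin d) (Fin d) ℝ := 1 - h • (A - lam • 1) with hBdef
  have hmap : B.map (algebraMap ℝ ℂ) =
      1 - (h : ℂ) • (A.map (algebraMap ℝ ℂ) - (lam : ℂ) • 1) := by
    ext i j
    by_cases hij : i = j <;> simp [hBdef, hij]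
  have hB : ∀ z ∈ spectrum ℂ (B.map (algebraMap ℝ ℂ)), ‖z‖ < 1 := by
    intro z hz
    rw [← Matrix.spectrum_toLin', ← Module.End.hasEigenvalue_iff_mem_spectrum] at hz
    obtain ⟨v, hv⟩ := hz.exists_hasEigenvector
    have hv1 := hv.apply_eq_smul
    have hh0 : (h : ℂ) ≠ 0 := by exact_mod_cast hpos.ne'
    have hv2 : (Matrix.toLin' (A.map (algebraMap ℝ ℂ))) v = (lam + (1 - z) / h : ℂ) • v := by
      rw [Matrix.toLin'_apply, hmap] at hv1
      rw [Matrix.toLin'_apply]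
      simp only [Matrix.sub_mulVec, Matrix.smul_mulVec, Matrix.one_mulVec] at hv1
      have e : (h : ℂ) • (A.map (algebraMap ℝ ℂ) *ᵥ v) =
          (h : ℂ) • ((lam + (1 - z) / h : ℂ) • v) := by
        rw [smul_smul, mul_add, mul_div_cancel₀ _ hh0, add_smul, sub_smul, ← hv1, one_smul,
          smul_sub, smul_smul]
        abel
      exact smul_right_injective _ hh0 e
    have hw : Module.End.HasEigenvalue (Matrix.toLin' (A.map (algebraMap ℝ ℂ)))
        (lam + (1 - z) / h : ℂ) :=
      Module.End.hasEigenvalue_of_hasEigenvector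
        ⟨Module.End.mem_eigenspace_iff.2 hv2, hv.2⟩
    rw [Module.End.hasEigenvalue_iff_mem_spectrum, Matrix.spectrum_toLin'] at hw
    have := hh _ hw
    rwa [add_sub_cancel_left, mul_div_cancel₀ _ hh0, sub_sub_cancel] at this
  set T := Matrix.toEuclideanCLM (n := Fin d) (𝕜 := ℝ) B with hT
  set TA := Matrix.toEuclideanCLM (n := Fin d) (𝕜 := ℝ) A with hTA
  have hTT : ∀ x, T x = x - h • (TA x - lam • x) := by
    intro x
    have : T = 1 - h • (TA - lam • 1) := by
      rw [hT, hBdef, map_sub, map_one, map_smul, map_sub, map_smul, map_one]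
    rw [this]; rfl
  obtain ⟨N, hN, hN1⟩ := (((tendsto_toEuclideanCLM_pow B hB).norm.eventually
    (gt_mem_nhds (by simp : ‖(0 : EuclideanSpace ℝ (Fin d) →L[ℝ] EuclideanSpace ℝ (Fin d))‖
      < 1))).and (Filter.eventually_ge_atTop 1)).exists
  refine ⟨N, orbitMap T N, fun x => ?_, fun x => ?_⟩
  · have : ‖x‖ ^ 2 ≤ ‖orbitMap T N x‖ ^ 2 := by
      rw [norm_orbitMap_sq]
      have := Finset.single_le_sum (f := fun k => ‖(T ^ k) x‖ ^ 2) (fun k _ => sq_nonneg _)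
        (Finset.mem_range.2 hN1)
      simpa using this
    exact le_of_sq_le_sq this (norm_nonneg _)
  · have h1 : ‖orbitMap T N (T x)‖ ^ 2 ≤ ‖orbitMap T N x‖ ^ 2 := by
      have e1 : ∑ k ∈ Finset.range N, ‖(T ^ k) (T x)‖ ^ 2 =
          ∑ k ∈ Finset.range N, ‖(T ^ (k + 1)) x‖ ^ 2 := by
        refine Finset.sum_congr rfl fun k _ => ?_
        rw [pow_succ]; rfl
      have e2 := Finset.sum_range_succ' (fun k => ‖(T ^ k) x‖ ^ 2) N
      rw [Finset.sum_range_succ] at e2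
      have e3 : ‖(T ^ N) x‖ ≤ ‖x‖ := by
        refine ((T ^ N).le_opNorm x).trans ?_
        have := mul_le_mul_of_nonneg_right hN.le (norm_nonneg x)
        rwa [one_mul] at this
      have e4 : ‖(T ^ N) x‖ ^ 2 ≤ ‖x‖ ^ 2 := by gcongr
      rw [norm_orbitMap_sq, norm_orbitMap_sq, e1]
      simp only [pow_zero, one_apply_eq_self] at e2
      linarith
    rw [hTT, map_sub, map_smul, map_sub, map_smul, norm_sub_sq_real, norm_smul,
      inner_smul_right, inner_sub_right, inner_smul_right, real_inner_self_eq_norm_sq] at h1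
    have h2 := sq_nonneg (‖h‖ * ‖orbitMap T N (TA x) - lam • orbitMap T N x‖)
    have h3 : 0 ≤ h * (inner ℝ (orbitMap T N x) (orbitMap T N (TA x))
        - lam * ‖orbitMap T N x‖ ^ 2) := by linarith
    have := nonneg_of_mul_nonneg_right h3 hpos
    linarith

/-- If `A` contracts by a factor `1 / 2`, then a Lyapunov rate of `A` is smaller than `1`: the
orbit `A ^ n x` decays at least like `2⁻ⁿ`, and at most like `lamⁿ` in the norm `‖J x‖`. -/
theorem lyapunov_rate_lt_one {E H : Type*} [NormedAddCommGroup E] [NormedSpace ℝ E]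
    [Nontrivial E] [NormedAddCommGroup H] [InnerProductSpace ℝ H] (A : E →L[ℝ] E)
    (hA : ∀ x, ‖A x‖ ≤ 1 / 2 * ‖x‖) (J : E →L[ℝ] H) (hJ : ∀ x, ‖x‖ ≤ ‖J x‖) (lam : ℝ)
    (hlyap : ∀ x, lam * ‖J x‖ ^ 2 ≤ inner ℝ (J x) (J (A x))) : lam < 1 := by
  by_contra! hcon
  have h1 : ∀ x, ‖J x‖ ≤ ‖J (A x)‖ := by
    intro x
    rcases (norm_nonneg (J x)).eq_or_lt with h0 | h0
    · rw [← h0]; exact norm_nonneg _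
    have h2 := (hlyap x).trans (real_inner_le_norm _ _)
    have h3 : ‖J x‖ ^ 2 ≤ lam * ‖J x‖ ^ 2 := le_mul_of_one_le_left (sq_nonneg _) hcon
    rw [sq] at h3 h2
    exact le_of_mul_le_mul_left (h3.trans h2) h0
  obtain ⟨x, hx⟩ := exists_ne (0 : E)
  have h2 : ∀ n : ℕ, ‖J x‖ ≤ ‖J ((A ^ n) x)‖ := by
    intro n
    induction n with
    | zero => simp
    | succ n ih =>
      rw [pow_succ']
      exact ih.trans (h1 _)
  have h3 : ∀ n : ℕ, ‖(A ^ n) x‖ ≤ (1 / 2) ^ n * ‖x‖ := by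
    intro n
    induction n with
    | zero => simp
    | succ n ih =>
      rw [pow_succ', pow_succ', mul_assoc]
      exact (hA _).trans (mul_le_mul_of_nonneg_left ih (by norm_num))
  have h4 : ∀ n : ℕ, ‖J x‖ ≤ ‖J‖ * ((1 / 2) ^ n * ‖x‖) := fun n =>
    (h2 n).trans ((J.le_opNorm _).trans (mul_le_mul_of_nonneg_left (h3 n) (norm_nonneg _)))
  have h5 : Filter.Tendsto (fun n : ℕ => ‖J‖ * ((1 / 2 : ℝ) ^ n * ‖x‖)) Filter.atTop (nhds 0) := by
    have := ((tendsto_pow_atTop_nhds_zero_of_lt_one (r := (1 / 2 : ℝ)) (by norm_num)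
      (by norm_num)).mul_const ‖x‖).const_mul ‖J‖
    simpa using this
  have h6 := ge_of_tendsto' h5 h4
  have h7 := norm_pos_iff.2 hx
  linarith [hJ x]

/-! ### One step of the moment recursion -/

/-- The rescaled squared error `1 + m ^ (2 κ) ‖v‖ ^ 2`: it stays bounded in time `m` when the
error `v` decays like `m ^ (-κ)`. -/
noncomputable def potential {H : Type*} [Norm H] (κ m : ℝ) (v : H) : ℝ :=
  1 + m ^ (2 * κ) * ‖v‖ ^ 2

theorem one_le_potential {H : Type*} [SeminormedAddGroup H] (κ : ℝ) {m : ℝ} (hm : 0 ≤ m) (v : H) :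
    1 ≤ potential κ m v :=
  le_add_of_nonneg_right (by positivity)

/-- Passing from time `m` to `m + 1` costs at most a factor `1 + 2 κ / m` in the scaling. -/
theorem potential_add_one_le {H : Type*} [NormedAddCommGroup H] [InnerProductSpace ℝ H]
    {G κ m : ℝ} (hκ : 0 < κ) (hκ2 : 2 * κ ≤ 1) (hm : 1 ≤ m) (v g : H)
    (hg : ‖g‖ ≤ G * (1 + ‖v‖)) :
    potential κ (m + 1) (v + (1 / m) • g) ≤
      1 + m ^ (2 * κ) * (1 + 2 * κ * (1 / m)) *
        (‖v‖ ^ 2 + 2 * (1 / m) * inner ℝ v g + (1 / m) ^ 2 * (2 * G ^ 2 * (1 + ‖v‖ ^ 2))) := by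
  have hm0 : 0 < m := by linarith
  have h1 : (m + 1) ^ (2 * κ) ≤ m ^ (2 * κ) * (1 + 2 * κ * (1 / m)) := by
    have e : m + 1 = m * (1 + 1 / m) := by field_simp
    rw [e, Real.mul_rpow hm0.le (by positivity)]
    gcongr
    have h0 : (0 : ℝ) ≤ 1 / m := by positivity
    exact rpow_one_add_le_one_add_mul_self (by linarith) (by linarith) hκ2
  have h2 : ‖g‖ ^ 2 ≤ 2 * G ^ 2 * (1 + ‖v‖ ^ 2) := by
    have h3 : ‖g‖ ^ 2 ≤ (G * (1 + ‖v‖)) ^ 2 := by gcongr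
    nlinarith [sq_nonneg (G * (1 - ‖v‖))]
  have h4 : ‖v + (1 / m) • g‖ ^ 2 ≤
      ‖v‖ ^ 2 + 2 * (1 / m) * inner ℝ v g + (1 / m) ^ 2 * (2 * G ^ 2 * (1 + ‖v‖ ^ 2)) := by
    rw [norm_add_sq_real, inner_smul_right, norm_smul, mul_pow, Real.norm_eq_abs, sq_abs]
    have := mul_le_mul_of_nonneg_left h2 (sq_nonneg (1 / m))
    linarith
  unfold potential
  have := mul_le_mul h1 h4 (sq_nonneg _) (by positivity)
  linarith

/-- The scalar estimates behind one step of the recursion. With `s = m ^ κ`, `a = 1 / m`,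
`D = ‖v‖` and `t = ⟪v, g⟫`, the relative increment `Y = α + β t` of the potential is of size
`s / m`, while its mean is only of size `(s / m) ^ 2`. -/
theorem relative_increment_bounds {G lam κ s a D : ℝ} (hG : 1 ≤ G) (hκ : 0 < κ)
    (hκl : κ ≤ lam) (hκ2 : 2 * κ ≤ 1) (hs : 1 ≤ s) (ha : 0 < a) (ha1 : a ≤ 1)
    (has1 : a * s ≤ 1) (hD : 0 ≤ D) :
    ∃ α β : ℝ, 0 ≤ β ∧
      (∀ t, 1 + s ^ 2 * (1 + 2 * κ * a) * (D ^ 2 + 2 * a * t + a ^ 2 * (2 * G ^ 2 * (1 + D ^ 2)))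
        = (1 + s ^ 2 * D ^ 2) * (1 + (α + β * t))) ∧
      α + β * (-(lam * D ^ 2)) ≤ 4 * G ^ 2 * (a * s) ^ 2 ∧
      (∀ t, |t| ≤ D * (G * (1 + D)) → |α + β * t| ≤ 17 * G ^ 2 * (a * s)) := by
  set U := 1 + s ^ 2 * D ^ 2 with hU
  have hU1 : 1 ≤ U := le_add_of_nonneg_right (by positivity)
  have hU0 : 0 < U := by linarith
  have hs0 : 0 < s := by linarith
  set c := 1 + 2 * κ * a with hc
  have hc1 : 1 ≤ c := le_add_of_nonneg_right (by positivity)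
  have hc2 : c ≤ 2 := by nlinarith
  have hs2 : 1 ≤ s ^ 2 := one_le_pow₀ hs
  set W := s ^ 2 * D ^ 2 with hW
  have hW0 : 0 ≤ W := by positivity
  have hG2 : G ≤ G ^ 2 := by nlinarith
  refine ⟨(W * (2 * κ * a) + c * (a ^ 2 * (2 * G ^ 2)) * (W + s ^ 2)) / U,
    c * (2 * a) * s ^ 2 / U, by positivity, fun t => ?_, ?_, fun t ht => ?_⟩
  · field_simp
    rw [hU, hW, hc]; ring
  · rw [div_mul_eq_mul_div, ← add_div, div_le_iff₀ hU0]
    have e1 : W + s ^ 2 ≤ s ^ 2 * U := by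
      rw [hU, mul_add, mul_one]
      nlinarith [mul_le_mul_of_nonneg_right hs2 hW0]
    have e2 : c * (a ^ 2 * (2 * G ^ 2)) * (W + s ^ 2) ≤ 2 * (a ^ 2 * (2 * G ^ 2)) * (s ^ 2 * U) := by
      gcongr
    have e3 : W * (2 * κ * a) ≤ c * (2 * a) * lam * W := by
      have : κ ≤ c * lam := by nlinarith
      nlinarith [mul_le_mul_of_nonneg_left this (by positivity : 0 ≤ 2 * a * W)]
    have e4 : c * (2 * a) * s ^ 2 * (-(lam * D ^ 2)) = -(c * (2 * a) * lam * W) := by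
      rw [hW]; ring
    rw [e4]
    nlinarith
  · rw [div_mul_eq_mul_div, ← add_div, abs_div, abs_of_pos hU0, div_le_iff₀ hU0]
    have hWU : W ≤ U := by rw [hU]; linarith
    have hsD : s * D ≤ U := by rw [hU, hW]; nlinarith [sq_nonneg (s * D - 1)]
    have has : a ≤ a * s := le_mul_of_one_le_right ha.le hs
    have hsU : (0 : ℝ) ≤ a * s * U := by positivity
    have f1 : W * (2 * κ * a) ≤ a * s * U := by
      calc W * (2 * κ * a) ≤ U * (1 * (a * s)) := by gcongr
        _ = a * s * U := by ring
    have f2 : c * (a ^ 2 * (2 * G ^ 2)) * (W + s ^ 2) ≤ 8 * G ^ 2 * (a * s * U) := by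
      have g1 : a ^ 2 * W ≤ a * s * U := by
        calc a ^ 2 * W = a * a * W := by ring
          _ ≤ 1 * (a * s) * U := by gcongr
          _ = _ := by ring
      have g2 : a ^ 2 * s ^ 2 ≤ a * s * U := by
        calc a ^ 2 * s ^ 2 = (a * s) * (a * s) := by ring
          _ ≤ (a * s) * U := by
            have := has1.trans hU1
            gcongr
      calc c * (a ^ 2 * (2 * G ^ 2)) * (W + s ^ 2)
          = c * (2 * G ^ 2 * (a ^ 2 * W + a ^ 2 * s ^ 2)) := by ring
        _ ≤ 2 * (2 * G ^ 2 * (a * s * U + a * s * U)) := by gcongr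
        _ = _ := by ring
    have f3 : |c * (2 * a) * s ^ 2 * t| ≤ 8 * G ^ 2 * (a * s * U) := by
      rw [abs_mul, abs_of_nonneg (by positivity : 0 ≤ c * (2 * a) * s ^ 2)]
      calc c * (2 * a) * s ^ 2 * |t| ≤ 2 * (2 * a) * s ^ 2 * (D * (G * (1 + D))) := by gcongr
        _ = 4 * G * (a * s * (s * D) + a * W) := by rw [hW]; ring
        _ ≤ 4 * G ^ 2 * (a * s * U + (a * s) * U) := by gcongr
        _ = _ := by ring
    have f4 : 0 ≤ W * (2 * κ * a) + c * (a ^ 2 * (2 * G ^ 2)) * (W + s ^ 2) := by positivity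
    have f5 := abs_add_le (W * (2 * κ * a) + c * (a ^ 2 * (2 * G ^ 2)) * (W + s ^ 2))
      (c * (2 * a) * s ^ 2 * t)
    rw [abs_of_nonneg f4] at f5
    have f6 : a * s * U ≤ G ^ 2 * (a * s * U) :=
      le_mul_of_one_le_left hsU (by nlinarith)
    linarith

/-- The second-order bound `(1 + y) ^ q ≤ e ^ (q y) ≤ 1 + q y + (q y) ^ 2` for `|q y| ≤ 1`. -/
theorem one_add_pow_le_of_abs_le {y : ℝ} {q : ℕ} (h : q * |y| ≤ 1) (hq : 1 ≤ q) :
    0 ≤ 1 + y ∧ (1 + y) ^ q ≤ 1 + q * y + (q * y) ^ 2 := by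
  have hq1 : (1 : ℝ) ≤ q := by exact_mod_cast hq
  have hy : |y| ≤ 1 := by nlinarith [abs_nonneg y]
  have h0 : 0 ≤ 1 + y := by linarith [neg_abs_le y]
  refine ⟨h0, ?_⟩
  have h1 : (1 + y) ^ q ≤ Real.exp (q * y) := by
    rw [Real.exp_nat_mul]
    gcongr
    linarith [Real.add_one_le_exp y]
  have h2 := Real.abs_exp_sub_one_sub_id_le (x := q * y) (by
    rwa [abs_mul, Nat.abs_cast])
  linarith [le_abs_self (Real.exp (q * y) - 1 - q * y)]

/-- One step of stochastic approximation, from the error `v` at time `m`, multiplies the `q`-th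
moment of the potential by at most `exp (O (q ^ 2 m ^ (2 κ - 2)))`. The drift
`⟪v, 𝔼 g⟫ ≤ - lam ‖v‖ ^ 2` with `κ ≤ lam` compensates the growth of the scaling. -/
theorem lintegral_potential_step_le {X H : Type*} [MeasurableSpace X] (ρ : Measure X)
    [IsProbabilityMeasure ρ] [NormedAddCommGroup H] [InnerProductSpace ℝ H]
    (v : H) (g : X → H) (hg : Integrable g ρ)
    {G lam κ m : ℝ} (hG : 1 ≤ G) (hκ : 0 < κ) (hκl : κ ≤ lam) (hκ2 : 2 * κ ≤ 1) (hm : 1 ≤ m)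
    (hbd : ∀ᵐ x ∂ρ, ‖g x‖ ≤ G * (1 + ‖v‖))
    (hmean : ∫ x, inner ℝ v (g x) ∂ρ ≤ -(lam * ‖v‖ ^ 2))
    {q : ℕ} (hq : 1 ≤ q) (hqm : 17 * G ^ 2 * q * m ^ (κ - 1) ≤ 1) :
    ∫⁻ x, ENNReal.ofReal (potential κ (m + 1) (v + (1 / m) • g x) ^ q) ∂ρ ≤
      ENNReal.ofReal (Real.exp (293 * G ^ 4 * (q ^ 2 * m ^ (2 * κ - 2)))) *
        ENNReal.ofReal (potential κ m v ^ q) := by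
  have hm0 : 0 < m := by linarith
  set s := m ^ κ with hs
  have hs1 : 1 ≤ s := Real.one_le_rpow hm hκ.le
  have hs2 : m ^ (2 * κ) = s ^ 2 := by
    rw [hs, ← Real.rpow_natCast, ← Real.rpow_mul hm0.le]; ring_nf
  have has : m ^ (κ - 1) = 1 / m * s := by
    rw [Real.rpow_sub hm0, Real.rpow_one]; ring
  have has2 : m ^ (2 * κ - 2) = (1 / m * s) ^ 2 := by
    rw [← has, ← Real.rpow_natCast, ← Real.rpow_mul hm0.le]; ring_nf
  have has0 : 0 ≤ 1 / m * s := by positivity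
  have has1 : 1 / m * s ≤ 1 := by
    rw [← has]; exact Real.rpow_le_one_of_one_le_of_nonpos hm (by linarith)
  obtain ⟨α, β, hβ, hid, hmeanY, hbdY⟩ := relative_increment_bounds (D := ‖v‖) hG hκ hκl hκ2 hs1
    (by positivity : 0 < 1 / m) ((div_le_one hm0).2 hm) has1 (norm_nonneg v)
  rw [has] at hqm
  rw [has2]
  set e := 1 / m * s with he
  set Y : X → ℝ := fun x => α + β * inner ℝ v (g x) with hY
  have hYint : Integrable Y ρ :=
    (integrable_const α).add ((hg.const_inner v).const_mul β)
  have hq0 : (0 : ℝ) ≤ q := Nat.cast_nonneg q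
  have hq1 : (1 : ℝ) ≤ q := by exact_mod_cast hq
  have hU0 : 0 ≤ potential κ m v ^ q :=
    pow_nonneg (zero_le_one.trans (one_le_potential κ hm0.le v)) _
  set Z : X → ℝ := fun x => 1 + q * Y x + (q * (17 * G ^ 2 * e)) ^ 2 with hZ
  have hpt : ∀ᵐ x ∂ρ, 0 ≤ Z x ∧
      potential κ (m + 1) (v + (1 / m) • g x) ^ q ≤ potential κ m v ^ q * Z x := by
    filter_upwards [hbd] with x hx
    have h1 := potential_add_one_le hκ hκ2 hm v (g x) hx
    have ht : |inner ℝ v (g x)| ≤ ‖v‖ * (G * (1 + ‖v‖)) :=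
      (abs_real_inner_le_norm _ _).trans (by gcongr)
    have h2 : |Y x| ≤ 17 * G ^ 2 * e := hbdY _ ht
    rw [hs2, hid] at h1
    have h3 : q * |Y x| ≤ 1 := by
      refine le_trans ?_ hqm
      calc q * |Y x| ≤ q * (17 * G ^ 2 * e) := by gcongr
        _ = _ := by ring
    obtain ⟨h4, h5⟩ := one_add_pow_le_of_abs_le h3 hq
    have h6 : (q * Y x) ^ 2 ≤ (q * (17 * G ^ 2 * e)) ^ 2 := by
      rw [← sq_abs (q * Y x), abs_mul, Nat.abs_cast]
      gcongr
    have h7 : (1 + Y x) ^ q ≤ Z x := by simp only [hZ]; linarith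
    refine ⟨(pow_nonneg h4 q).trans h7, ?_⟩
    have h8 : 1 + s ^ 2 * ‖v‖ ^ 2 = potential κ m v := by rw [potential, hs2]
    rw [h8] at h1
    calc potential κ (m + 1) (v + (1 / m) • g x) ^ q ≤ (potential κ m v * (1 + Y x)) ^ q := by
          have := one_le_potential κ (by linarith : 0 ≤ m + 1) (v + (1 / m) • g x)
          gcongr
      _ = potential κ m v ^ q * (1 + Y x) ^ q := mul_pow _ _ _
      _ ≤ _ := by gcongr
  have hZint : Integrable Z ρ :=
    ((integrable_const 1).add (hYint.const_mul _)).add (integrable_const _)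
  have hZle : ∫ x, Z x ∂ρ ≤ Real.exp (293 * G ^ 4 * (q ^ 2 * e ^ 2)) := by
    have h1 : ∫ x, Y x ∂ρ ≤ 4 * G ^ 2 * e ^ 2 := by
      simp only [hY]
      rw [integral_add (integrable_const α) ((hg.const_inner v).const_mul β), integral_const_mul]
      simp only [integral_const, probReal_univ, one_smul]
      refine le_trans ?_ hmeanY
      gcongr
    have h2 : ∫ x, Z x ∂ρ = 1 + q * ∫ x, Y x ∂ρ + (q * (17 * G ^ 2 * e)) ^ 2 := by
      simp only [hZ]
      have hI : Integrable (fun x => 1 + q * Y x) ρ :=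
        (integrable_const 1).add (hYint.const_mul _)
      rw [integral_add hI (integrable_const _), integral_add (integrable_const 1) (hYint.const_mul _),
        integral_const_mul]
      simp
    have h3 : (q : ℝ) * ∫ x, Y x ∂ρ ≤ q ^ 2 * (4 * G ^ 4 * e ^ 2) := by
      have hq2 : (q : ℝ) ≤ q ^ 2 := le_self_pow₀ hq1 two_ne_zero
      have hG4 : G ^ 2 ≤ G ^ 4 := pow_le_pow_right₀ hG (by norm_num)
      calc (q : ℝ) * ∫ x, Y x ∂ρ ≤ q * (4 * G ^ 2 * e ^ 2) := by gcongr
        _ ≤ q ^ 2 * (4 * G ^ 4 * e ^ 2) := by gcongr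
    rw [h2]
    refine le_trans ?_ (Real.add_one_le_exp _)
    linarith
  calc ∫⁻ x, ENNReal.ofReal (potential κ (m + 1) (v + (1 / m) • g x) ^ q) ∂ρ
      ≤ ∫⁻ x, ENNReal.ofReal (potential κ m v ^ q * Z x) ∂ρ :=
        lintegral_mono_ae (hpt.mono fun x hx => ENNReal.ofReal_le_ofReal hx.2)
    _ = ENNReal.ofReal (∫ x, potential κ m v ^ q * Z x ∂ρ) :=
        (ofReal_integral_eq_lintegral_ofReal (hZint.const_mul _)
          (hpt.mono fun x hx => mul_nonneg hU0 hx.1)).symm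
    _ ≤ ENNReal.ofReal (Real.exp (293 * G ^ 4 * (q ^ 2 * e ^ 2)) * potential κ m v ^ q) := by
        rw [integral_const_mul, mul_comm]
        exact ENNReal.ofReal_le_ofReal (mul_le_mul_of_nonneg_right hZle hU0)
    _ = _ := ENNReal.ofReal_mul (Real.exp_nonneg _)

/-! ### The increments of TD(0) -/

namespace TD

variable {d : ℕ}

/-- The samples `(φ, φ', r)`. -/
abbrev Sample (d : ℕ) := EuclideanSpace ℝ (Fin d) × EuclideanSpace ℝ (Fin d) × ℝ

/-- The TD(0) increment `(r + γ φ'ᵀ θ - φᵀ θ) φ`. -/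
noncomputable def increment (γ : ℝ) (θ : EuclideanSpace ℝ (Fin d)) (x : Sample d) :
    EuclideanSpace ℝ (Fin d) :=
  (x.2.2 + γ * inner ℝ x.2.1 θ - inner ℝ x.1 θ) • x.1

/-- The samples with features of norm at most `1 / 2` and reward in `[-1, 1]`. -/
def Sample.IsBounded (x : Sample d) : Prop := ‖x.1‖ ≤ 1 / 2 ∧ ‖x.2.1‖ ≤ 1 / 2 ∧ |x.2.2| ≤ 1

theorem iterate_succ (γ : ℝ) (α : ℕ → ℝ) (θ₀ : EuclideanSpace ℝ (Fin d)) (x : ℕ → Sample d)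
    (n : ℕ) : iterate γ α θ₀ x (n + 1) =
      iterate γ α θ₀ x n + α n • increment γ (iterate γ α θ₀ x n) (x n) := by
  rw [increment, smul_smul]
  rfl

theorem iterate_congr (γ : ℝ) (α : ℕ → ℝ) (θ₀ : EuclideanSpace ℝ (Fin d)) {x y : ℕ → Sample d}
    {n : ℕ} (h : ∀ k < n, x k = y k) : iterate γ α θ₀ x n = iterate γ α θ₀ y n := by
  induction n with
  | zero => rfl
  | succ n ih =>
    rw [iterate_succ, iterate_succ, ih fun k hk => h k (hk.trans n.lt_succ_self),
      h n n.lt_succ_self]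

theorem measurable_increment (γ : ℝ) :
    Measurable fun z : EuclideanSpace ℝ (Fin d) × Sample d => increment γ z.1 z.2 := by
  unfold increment
  fun_prop

theorem measurable_iterate {Ω : Type*} [MeasurableSpace Ω] (γ : ℝ) (α : ℕ → ℝ)
    (θ₀ : EuclideanSpace ℝ (Fin d)) {X : ℕ → Ω → Sample d} (hX : ∀ k, Measurable (X k)) (n : ℕ) :
    Measurable fun ω => iterate γ α θ₀ (fun k => X k ω) n := by
  induction n with
  | zero => exact measurable_const
  | succ n ih =>
    simp only [iterate_succ]
    have h : Measurable fun ω => increment γ (iterate γ α θ₀ (fun k => X k ω) n) (X n ω) :=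
      (measurable_increment γ).comp (ih.prodMk (hX n))
    fun_prop

theorem abs_inner_sub_inner_le {γ : ℝ} (hγ0 : 0 < γ) (hγ1 : γ < 1) {x : Sample d}
    (hx : x.IsBounded) (θ : EuclideanSpace ℝ (Fin d)) :
    |γ * inner ℝ x.2.1 θ - inner ℝ x.1 θ| ≤ ‖θ‖ := by
  obtain ⟨h1, h2, -⟩ := hx
  have h3 : |γ * inner ℝ x.2.1 θ| ≤ 1 * (1 / 2 * ‖θ‖) := by
    rw [abs_mul, abs_of_pos hγ0]
    exact mul_le_mul hγ1.le ((abs_real_inner_le_norm _ _).trans (by gcongr)) (abs_nonneg _)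
      zero_le_one
  have h4 : |(inner ℝ x.1 θ : ℝ)| ≤ 1 / 2 * ‖θ‖ := (abs_real_inner_le_norm _ _).trans (by gcongr)
  linarith [abs_sub (γ * inner ℝ x.2.1 θ) (inner ℝ x.1 θ)]

theorem norm_increment_le {γ : ℝ} (hγ0 : 0 < γ) (hγ1 : γ < 1) {x : Sample d}
    (hx : x.IsBounded) (θ : EuclideanSpace ℝ (Fin d)) : ‖increment γ θ x‖ ≤ 1 + ‖θ‖ := by
  have h1 := abs_inner_sub_inner_le hγ0 hγ1 hx θ
  have h2 : |x.2.2 + γ * inner ℝ x.2.1 θ - inner ℝ x.1 θ| ≤ 1 + ‖θ‖ := by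
    rw [add_sub_assoc]
    linarith [abs_add_le x.2.2 (γ * inner ℝ x.2.1 θ - inner ℝ x.1 θ), hx.2.2]
  rw [increment, norm_smul, Real.norm_eq_abs]
  have h3 : ‖x.1‖ ≤ 1 := hx.1.trans (by norm_num)
  calc _ ≤ (1 + ‖θ‖) * 1 := by gcongr
    _ = _ := mul_one _

variable {ρ : Measure (Sample d)} [IsProbabilityMeasure ρ]

theorem integrable_increment {γ : ℝ} (hγ0 : 0 < γ) (hγ1 : γ < 1)
    (hρ : ∀ᵐ x ∂ρ, Sample.IsBounded x) (θ : EuclideanSpace ℝ (Fin d)) :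
    Integrable (increment γ θ) ρ :=
  Integrable.of_bound
    ((measurable_increment γ).comp measurable_prodMk_left).aestronglyMeasurable (1 + ‖θ‖)
    (hρ.mono fun _ hx => norm_increment_le hγ0 hγ1 hx θ)

/-- The mean increment is `b - A θ`. -/
theorem integral_increment {γ : ℝ} (hγ0 : 0 < γ) (hγ1 : γ < 1)
    (hρ : ∀ᵐ x ∂ρ, Sample.IsBounded x) (θ : EuclideanSpace ℝ (Fin d)) :
    ∫ x, increment γ θ x ∂ρ = WithLp.toLp 2 (b ρ - A γ ρ *ᵥ WithLp.ofLp θ) := by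
  have hc : ∀ (v : EuclideanSpace ℝ (Fin d)) (i : Fin d), ‖v‖ ≤ 1 / 2 → |v i| ≤ 1 := fun v i hv =>
    (PiLp.norm_apply_le v i).trans (hv.trans (by norm_num))
  have hA : ∀ i j, Integrable (fun x : Sample d => x.1 i * (x.1 j - γ * x.2.1 j)) ρ := by
    intro i j
    refine Integrable.of_bound (by fun_prop) (1 * (1 + 1 * 1)) (hρ.mono fun x hx => ?_)
    rw [Real.norm_eq_abs, abs_mul]
    refine mul_le_mul (hc _ _ hx.1) ((abs_sub _ _).trans (add_le_add (hc _ _ hx.1) ?_))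
      (abs_nonneg _) zero_le_one
    rw [abs_mul, abs_of_pos hγ0]
    exact mul_le_mul hγ1.le (hc _ _ hx.2.1) (abs_nonneg _) zero_le_one
  have hb : ∀ i, Integrable (fun x : Sample d => x.2.2 * x.1 i) ρ := by
    intro i
    refine Integrable.of_bound (by fun_prop) (1 * 1) (hρ.mono fun x hx => ?_)
    rw [Real.norm_eq_abs, abs_mul]
    exact mul_le_mul hx.2.2 (hc _ _ hx.1) (abs_nonneg _) zero_le_one
  ext i
  have h1 := (EuclideanSpace.proj (𝕜 := ℝ) i).integral_comp_comm
    (integrable_increment hγ0 hγ1 hρ θ)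
  refine h1.symm.trans ?_
  have h2 : ∀ x : Sample d, EuclideanSpace.proj (𝕜 := ℝ) i (increment γ θ x) =
      x.2.2 * x.1 i - ∑ j, x.1 i * (x.1 j - γ * x.2.1 j) * θ j := by
    intro x
    simp only [increment, PiLp.proj_apply, PiLp.smul_apply, smul_eq_mul,
      PiLp.inner_apply, RCLike.inner_apply, conj_trivial]
    have : ∑ j, x.1 i * (x.1 j - γ * x.2.1 j) * θ j =
        x.1 i * (∑ j, θ j * x.1 j) - x.1 i * (γ * ∑ j, θ j * x.2.1 j) := by
      rw [Finset.mul_sum, Finset.mul_sum, Finset.mul_sum, ← Finset.sum_sub_distrib]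
      exact Finset.sum_congr rfl fun j _ => by ring
    rw [this]; ring
  simp only [h2]
  rw [integral_sub (hb i) (integrable_finsetSum _ fun j _ => (hA i j).mul_const _),
    integral_finsetSum _ fun j _ => (hA i j).mul_const _]
  simp only [integral_mul_const]
  rfl

/-- The mean increment is linear in the error `θ - θ*`, as `A θ* = b` for invertible `A`. -/
theorem integral_increment_eq_neg {γ : ℝ} (hγ0 : 0 < γ) (hγ1 : γ < 1)
    (hρ : ∀ᵐ x ∂ρ, Sample.IsBounded x) (hdet : IsUnit (A γ ρ).det)
    (θ : EuclideanSpace ℝ (Fin d)) :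
    ∫ x, increment γ θ x ∂ρ =
      -Matrix.toEuclideanCLM (n := Fin d) (𝕜 := ℝ) (A γ ρ) (θ - solution γ ρ) := by
  have h : A γ ρ *ᵥ ((A γ ρ)⁻¹ *ᵥ b ρ) = b ρ := by
    rw [Matrix.mulVec_mulVec, Matrix.mul_nonsing_inv _ hdet, Matrix.one_mulVec]
  rw [integral_increment hγ0 hγ1 hρ]
  ext i
  simp [solution, Matrix.ofLp_toEuclideanCLM, h]

/-- The difference of the increments at `0` and at `θ` has norm at most `‖θ‖ / 2` and mean `A θ`. -/
theorem norm_toEuclideanCLM_A_le {γ : ℝ} (hγ0 : 0 < γ) (hγ1 : γ < 1)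
    (hρ : ∀ᵐ x ∂ρ, Sample.IsBounded x) (θ : EuclideanSpace ℝ (Fin d)) :
    ‖Matrix.toEuclideanCLM (n := Fin d) (𝕜 := ℝ) (A γ ρ) θ‖ ≤ 1 / 2 * ‖θ‖ := by
  have h1 : Matrix.toEuclideanCLM (n := Fin d) (𝕜 := ℝ) (A γ ρ) θ =
      ∫ x, (increment γ 0 x - increment γ θ x) ∂ρ := by
    rw [integral_sub (integrable_increment hγ0 hγ1 hρ _) (integrable_increment hγ0 hγ1 hρ _),
      integral_increment hγ0 hγ1 hρ, integral_increment hγ0 hγ1 hρ]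
    ext i
    simp [Matrix.ofLp_toEuclideanCLM]
  rw [h1]
  have h2 := norm_integral_le_of_norm_le_const (μ := ρ) (C := 1 / 2 * ‖θ‖)
    (f := fun x => increment γ 0 x - increment γ θ x) (hρ.mono fun x hx => by
      rw [increment, increment, ← sub_smul, norm_smul, mul_comm (1 / 2), Real.norm_eq_abs]
      have h3 := abs_inner_sub_inner_le hγ0 hγ1 hx θ
      have h4 : x.2.2 + γ * inner ℝ x.2.1 (0 : EuclideanSpace ℝ (Fin d))
          - inner ℝ x.1 (0 : EuclideanSpace ℝ (Fin d))
          - (x.2.2 + γ * inner ℝ x.2.1 θ - inner ℝ x.1 θ) =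
          -(γ * inner ℝ x.2.1 θ - inner ℝ x.1 θ) := by
        rw [inner_zero_right, inner_zero_right]; ring
      rw [h4, abs_neg]
      exact mul_le_mul h3 hx.1 (norm_nonneg _) (norm_nonneg _))
  simpa using h2

end TD

/-! ### Moments of the iterates -/

namespace TD

variable {d : ℕ}

/-- The iterate `θ n` depends on the samples of index less than `n` only, so it is independent of
the sample of index `n`. -/
theorem indepFun_iterate {Ω : Type*} [MeasurableSpace Ω] {P : Measure Ω}
    {X : ℕ → Ω → Sample d} (hX : ∀ n, AEMeasurable (X n) P) (hind : iIndepFun X P)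
    (γ : ℝ) (α : ℕ → ℝ) (θ₀ : EuclideanSpace ℝ (Fin d)) (n : ℕ) :
    AEMeasurable (fun ω => iterate γ α θ₀ (fun k => X k ω) n) P ∧
      IndepFun (fun ω => iterate γ α θ₀ (fun k => X k ω) n) (X n) P := by
  set f : (Finset.range n → Sample d) → EuclideanSpace ℝ (Fin d) := fun y =>
    iterate γ α θ₀ (fun k => if h : k ∈ Finset.range n then y ⟨k, h⟩ else 0) n with hf
  have hfm : Measurable f := by
    refine measurable_iterate γ α θ₀ (X := fun k (y : Finset.range n → Sample d) =>
      if h : k ∈ Finset.range n then y ⟨k, h⟩ else 0) (fun k => ?_) n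
    by_cases hk : k ∈ Finset.range n
    · simp only [hk, dite_true]; exact measurable_pi_apply _
    · simp only [hk, dite_false]; exact measurable_const
  have heq : (fun ω => iterate γ α θ₀ (fun k => X k ω) n) =
      f ∘ fun ω (k : Finset.range n) => X k ω := by
    funext ω
    refine iterate_congr γ α θ₀ fun k hk => ?_
    simp [hk]
  have hind' := hind.indepFun_finset₀ (Finset.range n) {n} (by simp) hX
  rw [heq]
  refine ⟨hfm.comp_aemeasurable (aemeasurable_pi_lambda _ fun k => hX k), ?_⟩
  exact hind'.comp hfm (measurable_pi_apply (⟨n, Finset.mem_singleton_self n⟩ : ({n} : Finset ℕ)))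

/-- Averaging over the sample of index `n` first, with the iterate `θ n` frozen. -/
theorem lintegral_iterate_le {Ω : Type*} [MeasurableSpace Ω] {P : Measure Ω}
    [IsProbabilityMeasure P] {ρ : Measure (Sample d)} [IsProbabilityMeasure ρ]
    {X : ℕ → Ω → Sample d} (hX : ∀ n, HasLaw (X n) ρ P) (hind : iIndepFun X P)
    (γ : ℝ) (α : ℕ → ℝ) (θ₀ : EuclideanSpace ℝ (Fin d)) (n : ℕ)
    {F : EuclideanSpace ℝ (Fin d) → Sample d → ENNReal}
    (hF : Measurable fun z : EuclideanSpace ℝ (Fin d) × Sample d => F z.1 z.2)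
    {V : EuclideanSpace ℝ (Fin d) → ENNReal} (hV : Measurable V) (c : ENNReal)
    (hFV : ∀ θ, ∫⁻ x, F θ x ∂ρ ≤ c * V θ) :
    ∫⁻ ω, F (iterate γ α θ₀ (fun k => X k ω) n) (X n ω) ∂P ≤
      c * ∫⁻ ω, V (iterate γ α θ₀ (fun k => X k ω) n) ∂P := by
  obtain ⟨hm, hi⟩ := indepFun_iterate (fun n => (hX n).aemeasurable) hind γ α θ₀ n
  have hmap := (indepFun_iff_map_prod_eq_prod_map_map hm (hX n).aemeasurable).1 hi
  rw [(hX n).map_eq] at hmap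
  have : IsProbabilityMeasure (P.map fun ω => iterate γ α θ₀ (fun k => X k ω) n) :=
    Measure.isProbabilityMeasure_map hm
  calc ∫⁻ ω, F (iterate γ α θ₀ (fun k => X k ω) n) (X n ω) ∂P
      = ∫⁻ z, F z.1 z.2 ∂(P.map fun ω => (iterate γ α θ₀ (fun k => X k ω) n, X n ω)) :=
        (lintegral_map' hF.aemeasurable (hm.prodMk (hX n).aemeasurable)).symm
    _ = ∫⁻ θ, ∫⁻ x, F θ x ∂ρ ∂(P.map fun ω => iterate γ α θ₀ (fun k => X k ω) n) := by
        rw [hmap, lintegral_prod _ hF.aemeasurable]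
    _ ≤ ∫⁻ θ, c * V θ ∂(P.map fun ω => iterate γ α θ₀ (fun k => X k ω) n) :=
        lintegral_mono hFV
    _ = c * ∫⁻ ω, V (iterate γ α θ₀ (fun k => X k ω) n) ∂P := by
        rw [lintegral_const_mul _ hV, lintegral_map' hV.aemeasurable hm]

/-- The worst-case growth of the error along bounded samples is polynomial. -/
theorem one_add_norm_iterate_le {H : Type*} [NormedAddCommGroup H] [NormedSpace ℝ H]
    (J : EuclideanSpace ℝ (Fin d) →L[ℝ] H) (θs θ₀ : EuclideanSpace ℝ (Fin d)) (γ : ℝ) (G : ℕ)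
    (hG : ∀ θ x, Sample.IsBounded x → ‖J (increment γ θ x)‖ ≤ G * (1 + ‖J (θ - θs)‖))
    {x : ℕ → Sample d} (hx : ∀ n, (x n).IsBounded) (n : ℕ) :
    1 + ‖J (iterate γ (fun k => 1 / ((k : ℝ) + 1)) θ₀ x n - θs)‖ ≤
      (1 + ‖J (θ₀ - θs)‖) * ((n : ℝ) + 1) ^ G := by
  induction n with
  | zero => simp [iterate]
  | succ n ih =>
    rw [iterate_succ]
    set θ := iterate γ (fun k => 1 / ((k : ℝ) + 1)) θ₀ x n
    have h1 : J (θ + (1 / ((n : ℝ) + 1)) • increment γ θ (x n) - θs) =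
        J (θ - θs) + (1 / ((n : ℝ) + 1)) • J (increment γ θ (x n)) := by
      rw [add_sub_right_comm, map_add, map_smul]
    have hn : (0 : ℝ) < n + 1 := by positivity
    have h2 : ‖(1 / ((n : ℝ) + 1)) • J (increment γ θ (x n))‖ ≤
        1 / ((n : ℝ) + 1) * (G * (1 + ‖J (θ - θs)‖)) := by
      rw [norm_smul, Real.norm_eq_abs, abs_of_pos (by positivity)]
      exact mul_le_mul_of_nonneg_left (hG _ _ (hx n)) (by positivity)
    have h3 : 1 + G * (1 / ((n : ℝ) + 1)) ≤ (1 + 1 / ((n : ℝ) + 1)) ^ G :=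
      one_add_mul_le_pow (by linarith [show (0 : ℝ) ≤ 1 / ((n : ℝ) + 1) by positivity]) G
    have h4 : ((n : ℝ) + 1) ^ G * (1 + 1 / ((n : ℝ) + 1)) ^ G = (((n + 1 : ℕ) : ℝ) + 1) ^ G := by
      rw [← mul_pow]
      congr 1
      push_cast
      field_simp
    rw [h1, ← h4]
    calc 1 + ‖J (θ - θs) + (1 / ((n : ℝ) + 1)) • J (increment γ θ (x n))‖
        ≤ (1 + ‖J (θ - θs)‖) * (1 + G * (1 / ((n : ℝ) + 1))) := by
          have := norm_add_le (J (θ - θs)) ((1 / ((n : ℝ) + 1)) • J (increment γ θ (x n)))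
          linarith
      _ ≤ ((1 + ‖J (θ₀ - θs)‖) * ((n : ℝ) + 1) ^ G) * (1 + 1 / ((n : ℝ) + 1)) ^ G := by
          gcongr
      _ = _ := by ring

theorem potential_iterate_le {H : Type*} [NormedAddCommGroup H] [NormedSpace ℝ H]
    (J : EuclideanSpace ℝ (Fin d) →L[ℝ] H) (θs θ₀ : EuclideanSpace ℝ (Fin d)) (γ : ℝ) (G : ℕ)
    (hG : ∀ θ x, Sample.IsBounded x → ‖J (increment γ θ x)‖ ≤ G * (1 + ‖J (θ - θs)‖))
    {x : ℕ → Sample d} (hx : ∀ n, (x n).IsBounded) {κ : ℝ} (hκ2 : 2 * κ ≤ 1) (n : ℕ) :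
    potential κ ((n : ℝ) + 1) (J (iterate γ (fun k => 1 / ((k : ℝ) + 1)) θ₀ x n - θs)) ≤
      (1 + ‖J (θ₀ - θs)‖) ^ 2 * ((n : ℝ) + 1) ^ (2 * G + 1) := by
  have h1 := one_add_norm_iterate_le J θs θ₀ γ G hG hx n
  set D := ‖J (iterate γ (fun k => 1 / ((k : ℝ) + 1)) θ₀ x n - θs)‖
  have hD : 0 ≤ D := norm_nonneg _
  have hn : (1 : ℝ) ≤ n + 1 := by linarith [(Nat.cast_nonneg n : (0 : ℝ) ≤ n)]
  have h2 : ((n : ℝ) + 1) ^ (2 * κ) ≤ n + 1 := by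
    simpa using Real.rpow_le_rpow_of_exponent_le hn hκ2
  calc 1 + ((n : ℝ) + 1) ^ (2 * κ) * D ^ 2 ≤ (n + 1) * (1 + D) ^ 2 := by
        nlinarith [mul_le_mul_of_nonneg_right h2 (sq_nonneg D)]
    _ ≤ (n + 1) * ((1 + ‖J (θ₀ - θs)‖) * ((n : ℝ) + 1) ^ G) ^ 2 := by gcongr
    _ = _ := by ring

/-- The `q`-th moment of the potential is at most `(e ^ (c S) B) ^ q`, with `B` a worst-case bound
at time `n₀`, provided that `n₀` exceeds a power of `q`: up to time `n₀` by the worst-case bound,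
and later because the factors `exp (c q ^ 2 m ^ (2 κ - 2))`, for `m ≥ n₀`, are dominated by the
factors `exp (c m ^ (-σ))` of a convergent product. -/
theorem lintegral_potential_iterate_le {Ω : Type*} [MeasurableSpace Ω] {P : Measure Ω}
    [IsProbabilityMeasure P] {ρ : Measure (Sample d)} [IsProbabilityMeasure ρ]
    {X : ℕ → Ω → Sample d} (hX : ∀ n, HasLaw (X n) ρ P) (hind : iIndepFun X P)
    (hρ : ∀ᵐ x ∂ρ, Sample.IsBounded x)
    {γ : ℝ} (hγ0 : 0 < γ) (hγ1 : γ < 1)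
    {H : Type*} [NormedAddCommGroup H] [InnerProductSpace ℝ H] [CompleteSpace H]
    (J : EuclideanSpace ℝ (Fin d) →L[ℝ] H) (θs θ₀ : EuclideanSpace ℝ (Fin d))
    {G : ℕ} (hG1 : 1 ≤ G)
    (hG : ∀ θ x, Sample.IsBounded x → ‖J (increment γ θ x)‖ ≤ G * (1 + ‖J (θ - θs)‖))
    {lam κ : ℝ} (hκ : 0 < κ) (hκl : κ ≤ lam) (hκ2 : 2 * κ ≤ 1)
    (hmean : ∀ θ, inner ℝ (J (θ - θs)) (J (∫ x, increment γ θ x ∂ρ)) ≤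
      -(lam * ‖J (θ - θs)‖ ^ 2))
    {q n₀ : ℕ} (hq : 1 ≤ q) {σ : ℝ}
    (hn₀ : ∀ m : ℝ, n₀ ≤ m → 17 * (G : ℝ) ^ 2 * q * m ^ (κ - 1) ≤ 1 ∧
      (q : ℝ) ^ 2 * m ^ (2 * κ - 2) ≤ m ^ (-σ)) (n : ℕ) :
    ∫⁻ ω, ENNReal.ofReal (potential κ ((n : ℝ) + 1)
        (J (iterate γ (fun k => 1 / ((k : ℝ) + 1)) θ₀ (fun k => X k ω) n - θs)) ^ q) ∂P ≤
      ENNReal.ofReal (Real.exp (∑ k ∈ Finset.range n, 293 * (G : ℝ) ^ 4 * ((k : ℝ) + 1) ^ (-σ)) *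
        ((1 + ‖J (θ₀ - θs)‖) ^ 2 * ((n₀ : ℝ) + 1) ^ (2 * G + 1)) ^ q) := by
  set B := (1 + ‖J (θ₀ - θs)‖) ^ 2 * ((n₀ : ℝ) + 1) ^ (2 * G + 1) with hB
  have hB0 : 0 ≤ B := by positivity
  have hXb : ∀ᵐ ω ∂P, ∀ n, (X n ω).IsBounded := by
    rw [ae_all_iff]
    intro n
    have h := hρ
    rw [← (hX n).map_eq] at h
    exact ae_of_ae_map (hX n).aemeasurable h
  have hearly : ∀ n ≤ n₀, ∫⁻ ω, ENNReal.ofReal (potential κ ((n : ℝ) + 1)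
        (J (iterate γ (fun k => 1 / ((k : ℝ) + 1)) θ₀ (fun k => X k ω) n - θs)) ^ q) ∂P ≤
      ENNReal.ofReal (Real.exp (∑ k ∈ Finset.range n, 293 * (G : ℝ) ^ 4 * ((k : ℝ) + 1) ^ (-σ)) *
        B ^ q) := by
    intro n hn
    calc _ ≤ ∫⁻ _, ENNReal.ofReal (B ^ q) ∂P := by
          refine lintegral_mono_ae (hXb.mono fun ω hω => ENNReal.ofReal_le_ofReal ?_)
          have h1 := one_le_potential κ (by positivity : (0 : ℝ) ≤ n + 1)
            (J (iterate γ (fun k => 1 / ((k : ℝ) + 1)) θ₀ (fun k => X k ω) n - θs))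
          have h2 := potential_iterate_le J θs θ₀ γ G hG hω hκ2 n
          refine pow_le_pow_left₀ (by linarith) (h2.trans ?_) q
          have : (n : ℝ) ≤ n₀ := by exact_mod_cast hn
          rw [hB]
          gcongr
      _ = ENNReal.ofReal (B ^ q) := by simp
      _ ≤ _ := ENNReal.ofReal_le_ofReal (le_mul_of_one_le_left (by positivity)
          (Real.one_le_exp (Finset.sum_nonneg fun k _ => by positivity)))
  induction n with
  | zero => exact hearly 0 n₀.zero_le
  | succ n ih =>
    rcases le_or_gt (n + 1) n₀ with hn | hn
    · exact hearly _ hn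
    have hn1 : (n₀ : ℝ) ≤ (n : ℝ) + 1 := by exact_mod_cast hn.le
    obtain ⟨hs1, hs2⟩ := hn₀ _ hn1
    have hm1 : (1 : ℝ) ≤ n + 1 := by linarith [(Nat.cast_nonneg n : (0 : ℝ) ≤ n)]
    set V : EuclideanSpace ℝ (Fin d) → ENNReal := fun θ =>
      ENNReal.ofReal (potential κ ((n : ℝ) + 1) (J (θ - θs)) ^ q) with hVdef
    set F : EuclideanSpace ℝ (Fin d) → Sample d → ENNReal := fun θ x =>
      ENNReal.ofReal (potential κ ((n : ℝ) + 1 + 1)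
        (J (θ - θs) + (1 / ((n : ℝ) + 1)) • J (increment γ θ x)) ^ q) with hFdef
    have hVm : Measurable V := by
      have : Continuous fun θ => potential κ ((n : ℝ) + 1) (J (θ - θs)) ^ q := by
        unfold potential; fun_prop
      exact this.measurable.ennreal_ofReal
    have hFm : Measurable fun z : EuclideanSpace ℝ (Fin d) × Sample d => F z.1 z.2 := by
      have : Continuous fun z : EuclideanSpace ℝ (Fin d) × Sample d =>
          potential κ ((n : ℝ) + 1 + 1)
            (J (z.1 - θs) + (1 / ((n : ℝ) + 1)) • J (increment γ z.1 z.2)) ^ q := by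
        unfold potential increment; fun_prop
      exact this.measurable.ennreal_ofReal
    have hstep : ∀ θ, ∫⁻ x, F θ x ∂ρ ≤
        ENNReal.ofReal (Real.exp (293 * (G : ℝ) ^ 4 * (q ^ 2 * ((n : ℝ) + 1) ^ (2 * κ - 2))))
          * V θ := by
      intro θ
      have hint := integrable_increment hγ0 hγ1 hρ θ
      have hJint : Integrable (fun x => J (increment γ θ x)) ρ := J.integrable_comp hint
      refine lintegral_potential_step_le ρ (J (θ - θs)) (fun x => J (increment γ θ x)) hJint
        (by exact_mod_cast hG1) hκ hκl hκ2 hm1 (hρ.mono fun x hx => hG θ x hx) ?_ hq hs1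
      rw [integral_inner hJint, J.integral_comp_comm hint]
      exact hmean θ
    have hmain := lintegral_iterate_le hX hind γ (fun k => 1 / ((k : ℝ) + 1)) θ₀ n hFm hVm _ hstep
    have hrew : ∀ ω, ENNReal.ofReal (potential κ (((n + 1 : ℕ) : ℝ) + 1)
        (J (iterate γ (fun k => 1 / ((k : ℝ) + 1)) θ₀ (fun k => X k ω) (n + 1) - θs)) ^ q) =
        F (iterate γ (fun k => 1 / ((k : ℝ) + 1)) θ₀ (fun k => X k ω) n) (X n ω) := by
      intro ω
      rw [iterate_succ, hFdef]
      simp only [add_sub_right_comm, map_add, map_smul, Nat.cast_add, Nat.cast_one]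
    simp only [hrew]
    refine hmain.trans ?_
    calc _ ≤ ENNReal.ofReal (Real.exp (293 * (G : ℝ) ^ 4 * ((n : ℝ) + 1) ^ (-σ))) *
          ENNReal.ofReal (Real.exp (∑ k ∈ Finset.range n,
            293 * (G : ℝ) ^ 4 * ((k : ℝ) + 1) ^ (-σ)) * B ^ q) := by
          gcongr
      _ = _ := by
          rw [← ENNReal.ofReal_mul (Real.exp_nonneg _), ← mul_assoc, ← Real.exp_add,
            Finset.sum_range_succ, add_comm]

end TD

/-! ### Tail bounds -/

namespace TD

variable {d : ℕ}

/-- For `m` beyond a fixed power of `Q ≥ q`, the error terms of one step are small, and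
summable uniformly in `q`. -/
theorem step_conditions_of_pow_le {κ Q q m : ℝ} {L : ℕ} (hκ : 2 * κ < 1) (hL2 : 2 ≤ L)
    (hL : 4 / (1 - 2 * κ) ≤ L) (hq : 0 ≤ q) (hqQ : q ≤ Q) (hQ : 1 ≤ Q) (hm : Q ^ L ≤ m) :
    Q * m ^ (κ - 1) ≤ 1 ∧ q ^ 2 * m ^ (2 * κ - 2) ≤ m ^ (-(1 + (1 - 2 * κ) / 2)) := by
  have hm1 : 1 ≤ m := (one_le_pow₀ hQ).trans hm
  have hm0 : 0 < m := by linarith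
  have hQ0 : 0 ≤ Q := by linarith
  constructor
  · have h1 : Q ≤ m ^ (1 / 2 : ℝ) := by
      rw [← Real.sqrt_eq_rpow]
      exact Real.le_sqrt_of_sq_le ((pow_le_pow_right₀ hQ hL2).trans hm)
    calc Q * m ^ (κ - 1) ≤ m ^ (1 / 2 : ℝ) * m ^ (-(1 / 2) : ℝ) := by
          gcongr
          linarith
      _ = 1 := by rw [← Real.rpow_add hm0]; simp
  · have hs : 0 < 1 - 2 * κ := by linarith
    have h2 : q ^ 2 ≤ m ^ ((1 - 2 * κ) / 2) := by
      calc q ^ 2 ≤ Q ^ 2 := by gcongr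
        _ = (Q ^ (4 / (1 - 2 * κ))) ^ ((1 - 2 * κ) / 2) := by
          rw [← Real.rpow_mul hQ0, ← Real.rpow_natCast]
          congr 1
          push_cast
          field_simp
          norm_num
        _ ≤ (Q ^ L) ^ ((1 - 2 * κ) / 2) := by
          rw [← Real.rpow_natCast Q L]
          gcongr
        _ ≤ m ^ ((1 - 2 * κ) / 2) := by gcongr
    calc q ^ 2 * m ^ (2 * κ - 2) ≤ m ^ ((1 - 2 * κ) / 2) * m ^ (2 * κ - 2) := by gcongr
      _ = _ := by
        rw [← Real.rpow_add hm0]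
        congr 1
        ring

/-- Markov's inequality for the `q`-th power: a moment bound `R ^ q` with `q ≥ log (1 / δ)` gives
`f ≤ e R` outside an event of probability `e ^ (-q) ≤ δ`. -/
theorem real_le_of_lintegral_pow_le {Ω : Type*} [MeasurableSpace Ω] {P : Measure Ω}
    [IsProbabilityMeasure P] {f : Ω → ℝ} (hf : AEMeasurable f P) {R δ : ℝ} (hR : 0 < R)
    {q : ℕ} (hint : ∫⁻ ω, ENNReal.ofReal (f ω ^ q) ∂P ≤ ENNReal.ofReal (R ^ q))
    (hδ : 0 < δ) (hq : Real.log (1 / δ) ≤ q) :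
    1 - δ ≤ P.real {ω | f ω ≤ Real.exp 1 * R} := by
  have hmarkov := mul_meas_ge_le_lintegral₀ (μ := P) (f := fun ω => ENNReal.ofReal (f ω ^ q))
    (hf.pow_const q).ennreal_ofReal (ENNReal.ofReal ((Real.exp 1 * R) ^ q))
  set bad := {ω | ENNReal.ofReal ((Real.exp 1 * R) ^ q) ≤ ENNReal.ofReal (f ω ^ q)}
  have h1 : (Real.exp 1 * R) ^ q * P.real bad ≤ R ^ q := by
    have h2 := ENNReal.toReal_mono ENNReal.ofReal_ne_top (hmarkov.trans hint)
    rwa [ENNReal.toReal_mul, ENNReal.toReal_ofReal (by positivity),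
      ENNReal.toReal_ofReal (by positivity)] at h2
  have h3 : P.real bad ≤ δ := by
    rw [mul_pow, mul_assoc, mul_comm (R ^ q), ← mul_assoc] at h1
    have h4 : Real.exp 1 ^ q * P.real bad ≤ 1 :=
      le_of_mul_le_mul_right (by linarith) (pow_pos hR q)
    have h5 : 1 / δ ≤ Real.exp 1 ^ q := by
      rw [← Real.exp_nat_mul, mul_one, ← Real.exp_log (by positivity : 0 < 1 / δ)]
      exact Real.exp_le_exp.2 hq
    have h6 : 1 / δ * P.real bad ≤ 1 :=
      (mul_le_mul_of_nonneg_right h5 measureReal_nonneg).trans h4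
    rwa [one_div_mul_eq_div, div_le_one hδ] at h6
  have h7 : (1 : ℝ) ≤ P.real {ω | f ω ≤ Real.exp 1 * R} + P.real bad := by
    refine (probReal_univ (μ := P)).symm.le.trans
      ((measureReal_mono ?_).trans (measureReal_union_le _ _))
    intro ω _
    rcases le_or_gt (f ω) (Real.exp 1 * R) with h | h
    · exact Or.inl h
    · refine Or.inr (ENNReal.ofReal_le_ofReal ?_)
      gcongr
  linarith

/-- A Lyapunov map `J` of rate `lam` gives the rate `n ^ (-κ)` for every `κ ≤ lam` below `1 / 2`,
with polynomial dependence on `log (1 / δ)`. -/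
theorem exists_tail_bound {ρ : Measure (Sample d)} [IsProbabilityMeasure ρ]
    (hρ : ∀ᵐ x ∂ρ, Sample.IsBounded x) {γ : ℝ} (hγ0 : 0 < γ) (hγ1 : γ < 1)
    {H : Type*} [NormedAddCommGroup H] [InnerProductSpace ℝ H] [CompleteSpace H]
    (J : EuclideanSpace ℝ (Fin d) →L[ℝ] H) (hJ : ∀ x, ‖x‖ ≤ ‖J x‖)
    (θs θ₀ : EuclideanSpace ℝ (Fin d))
    {lam κ : ℝ} (hκ : 0 < κ) (hκl : κ ≤ lam) (hκ2 : 2 * κ < 1)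
    (hmean : ∀ θ, inner ℝ (J (θ - θs)) (J (∫ x, increment γ θ x ∂ρ)) ≤
      -(lam * ‖J (θ - θs)‖ ^ 2)) :
    ∃ (C : ℝ) (p : ℕ), ∀ (Ω : Type*) [MeasurableSpace Ω] (P : Measure Ω)
      [IsProbabilityMeasure P] (X : ℕ → Ω → Sample d), (∀ n, HasLaw (X n) ρ P) → iIndepFun X P →
      ∀ δ : ℝ, 0 < δ → δ < 1 → ∀ n : ℕ, 1 ≤ n →
        1 - δ ≤ P.real {ω |
          ‖iterate γ (fun k => 1 / ((k : ℝ) + 1)) θ₀ (fun k => X k ω) n - θs‖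
            ≤ C * (1 + Real.log n + Real.log (1 / δ)) ^ p * (n : ℝ) ^ (-κ)} := by
  obtain ⟨G, hG1, hG⟩ : ∃ G : ℕ, 1 ≤ G ∧ ∀ θ x, Sample.IsBounded x →
      ‖J (increment γ θ x)‖ ≤ G * (1 + ‖J (θ - θs)‖) := by
    refine ⟨⌈‖J‖ * (1 + ‖θs‖)⌉₊ + 1, by omega, fun θ x hx => ?_⟩
    have h1 : ‖θ‖ ≤ ‖θs‖ + ‖J (θ - θs)‖ :=
      (norm_le_norm_add_norm_sub' θ θs).trans (by gcongr; exact hJ _)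
    have h2 : 1 + ‖θ‖ ≤ (1 + ‖θs‖) * (1 + ‖J (θ - θs)‖) := by
      nlinarith [mul_nonneg (norm_nonneg θs) (norm_nonneg (J (θ - θs)))]
    have h3 : ‖J‖ * (1 + ‖θs‖) ≤ (⌈‖J‖ * (1 + ‖θs‖)⌉₊ + 1 : ℕ) := by
      push_cast
      linarith [Nat.le_ceil (‖J‖ * (1 + ‖θs‖))]
    calc ‖J (increment γ θ x)‖ ≤ ‖J‖ * (1 + ‖θ‖) :=
          (J.le_opNorm _).trans (by gcongr; exact norm_increment_le hγ0 hγ1 hx θ)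
      _ ≤ ‖J‖ * ((1 + ‖θs‖) * (1 + ‖J (θ - θs)‖)) := by gcongr
      _ = ‖J‖ * (1 + ‖θs‖) * (1 + ‖J (θ - θs)‖) := by ring
      _ ≤ _ := by gcongr
  have hG1' : (1 : ℝ) ≤ G := by exact_mod_cast hG1
  -- `n₀ = (17 G² q) ^ L` is the time from which the one-step moment estimate applies
  obtain ⟨L, hL2, hL⟩ : ∃ L : ℕ, 2 ≤ L ∧ 4 / (1 - 2 * κ) ≤ L :=
    ⟨⌈4 / (1 - 2 * κ)⌉₊ + 2, by omega, by push_cast; linarith [Nat.le_ceil (4 / (1 - 2 * κ))]⟩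
  set σ := 1 + (1 - 2 * κ) / 2 with hσ
  have hsum : Summable fun k : ℕ => 293 * (G : ℝ) ^ 4 * ((k : ℝ) + 1) ^ (-σ) := by
    refine Summable.mul_left _ ?_
    have := (summable_nat_add_iff 1).2 (Real.summable_nat_rpow.2 (by linarith : -σ < -1))
    simpa using this
  set S := ∑' k : ℕ, 293 * (G : ℝ) ^ 4 * ((k : ℝ) + 1) ^ (-σ) with hS
  have hS0 : 0 ≤ S := tsum_nonneg fun k => by positivity
  set D := 1 + ‖J (θ₀ - θs)‖ with hD
  have hD1 : 1 ≤ D := le_add_of_nonneg_right (norm_nonneg _)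
  refine ⟨Real.exp 1 * (Real.exp S * (D ^ 2 * (2 * (17 * (G : ℝ) ^ 2) ^ L) ^ (2 * G + 1))),
    L * (2 * G + 1), ?_⟩
  intro Ω _ P _ X hX hind δ hδ0 hδ1 n hn
  have hl : 0 < Real.log (1 / δ) := Real.log_pos (by rwa [lt_div_iff₀ hδ0, one_mul])
  have hlogn : 0 ≤ Real.log n := Real.log_natCast_nonneg n
  set Λ := 1 + Real.log n + Real.log (1 / δ) with hΛ
  set q := ⌈Real.log (1 / δ)⌉₊ with hqdef
  have hq : 1 ≤ q := Nat.ceil_pos.2 hl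
  have hq1 : (1 : ℝ) ≤ q := by exact_mod_cast hq
  have hqΛ : (q : ℝ) ≤ Λ := by linarith [Nat.ceil_lt_add_one hl.le]
  set n₀ := (17 * G ^ 2 * q) ^ L with hn₀
  have hn₀' : (n₀ : ℝ) = (17 * (G : ℝ) ^ 2 * q) ^ L := by rw [hn₀]; push_cast; rfl
  have hG2 : (1 : ℝ) ≤ 17 * (G : ℝ) ^ 2 := by nlinarith
  have hQ1 : (1 : ℝ) ≤ 17 * (G : ℝ) ^ 2 * q := one_le_mul_of_one_le_of_one_le hG2 hq1
  set B := D ^ 2 * ((n₀ : ℝ) + 1) ^ (2 * G + 1) with hB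
  have hB1 : 1 ≤ B := one_le_mul_of_one_le_of_one_le (one_le_pow₀ hD1)
    (one_le_pow₀ (by linarith [(Nat.cast_nonneg n₀ : (0 : ℝ) ≤ n₀)]))
  have hmom := lintegral_potential_iterate_le hX hind hρ hγ0 hγ1 J θs θ₀ hG1 hG hκ hκl hκ2.le
    hmean hq (n₀ := n₀) (σ := σ) (fun m hm => step_conditions_of_pow_le hκ2 hL2 hL (by linarith)
      (le_mul_of_one_le_left (by linarith) hG2) hQ1 (hn₀' ▸ hm)) n
  have hR : Real.exp (∑ k ∈ Finset.range n, 293 * (G : ℝ) ^ 4 * ((k : ℝ) + 1) ^ (-σ)) * B ^ q ≤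
      (Real.exp S * B) ^ q := by
    rw [mul_pow (Real.exp S) B]
    refine mul_le_mul_of_nonneg_right ?_ (by positivity)
    calc _ ≤ Real.exp S :=
          Real.exp_le_exp.2 (hsum.sum_le_tsum _ fun k _ => by positivity)
      _ ≤ Real.exp S ^ q := le_self_pow₀ (Real.one_le_exp hS0) (by omega)
  have hmeas : AEMeasurable (fun ω => potential κ ((n : ℝ) + 1)
      (J (iterate γ (fun k => 1 / ((k : ℝ) + 1)) θ₀ (fun k => X k ω) n - θs))) P := by
    have h := (indepFun_iterate (fun n => (hX n).aemeasurable) hind γ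
      (fun k => 1 / ((k : ℝ) + 1)) θ₀ n).1
    have hc : Continuous fun θ => potential κ ((n : ℝ) + 1) (J (θ - θs)) := by
      unfold potential; fun_prop
    exact hc.measurable.comp_aemeasurable h
  refine (real_le_of_lintegral_pow_le hmeas (R := Real.exp S * B) (by positivity)
    (hmom.trans (ENNReal.ofReal_le_ofReal hR)) hδ0 (Nat.le_ceil _)).trans (measureReal_mono ?_)
  intro ω hω
  simp only [Set.mem_ofPred_eq, potential] at hω ⊢
  set Δ := iterate γ (fun k => 1 / ((k : ℝ) + 1)) θ₀ (fun k => X k ω) n - θs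
  set R := Real.exp 1 * (Real.exp S * B) with hRdef
  have hR1 : 1 ≤ R := one_le_mul_of_one_le_of_one_le (Real.one_le_exp zero_le_one)
    (one_le_mul_of_one_le_of_one_le (Real.one_le_exp hS0) hB1)
  have hn0 : (0 : ℝ) < n := by exact_mod_cast hn
  have h1 : ((n : ℝ) ^ κ * ‖Δ‖) ^ 2 ≤ R ^ 2 := by
    calc ((n : ℝ) ^ κ * ‖Δ‖) ^ 2 = (n : ℝ) ^ (2 * κ) * ‖Δ‖ ^ 2 := by
          rw [mul_pow, ← Real.rpow_natCast ((n : ℝ) ^ κ), ← Real.rpow_mul hn0.le]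
          ring_nf
      _ ≤ ((n : ℝ) + 1) ^ (2 * κ) * ‖J Δ‖ ^ 2 := by
          gcongr
          · linarith
          · exact hJ _
      _ ≤ R := by linarith
      _ ≤ R ^ 2 := le_self_pow₀ hR1 two_ne_zero
  have h2 : (n : ℝ) ^ κ * ‖Δ‖ ≤ R := le_of_sq_le_sq h1 (by linarith)
  have h3 : ‖Δ‖ ≤ R * (n : ℝ) ^ (-κ) := by
    rw [Real.rpow_neg hn0.le, ← div_eq_mul_inv, le_div_iff₀ (by positivity), mul_comm]
    exact h2
  refine h3.trans ?_
  have h4 : (n₀ : ℝ) + 1 ≤ 2 * (17 * (G : ℝ) ^ 2) ^ L * Λ ^ L := by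
    have h5 : (1 : ℝ) ≤ n₀ := by rw [hn₀']; exact one_le_pow₀ hQ1
    calc (n₀ : ℝ) + 1 ≤ 2 * n₀ := by linarith
      _ = 2 * (17 * (G : ℝ) ^ 2) ^ L * (q : ℝ) ^ L := by rw [hn₀', mul_pow _ (q : ℝ)]; ring
      _ ≤ _ := by gcongr
  gcongr
  calc R ≤ Real.exp 1 * (Real.exp S * (D ^ 2 *
        (2 * (17 * (G : ℝ) ^ 2) ^ L * Λ ^ L) ^ (2 * G + 1))) := by
        rw [hRdef, hB]; gcongr
    _ = _ := by rw [mul_pow (2 * (17 * (G : ℝ) ^ 2) ^ L), ← pow_mul]; ring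

end TD

/-! ### The sampling law of the Markov decision process -/

theorem MDP.isProbabilityMeasure_sampleLaw {S Act : Type*} [MeasurableSpace S]
    [MeasurableSpace Act] (M : MDP S Act) (pol : S → Act) (hpol : Measurable pol)
    (ν : Measure S) [IsProbabilityMeasure ν] {d : ℕ} {φ : S → EuclideanSpace ℝ (Fin d)}
    (hφ : Measurable φ) : IsProbabilityMeasure (M.sampleLaw pol hpol ν φ) := by
  have := M.trans_markov
  have := M.reward_markov
  have : IsMarkovKernel (M.chain pol hpol) := by unfold MDP.chain; infer_instance
  have : IsMarkovKernel (M.chainReward pol hpol) := by unfold MDP.chainReward; infer_instance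
  unfold MDP.sampleLaw MDP.transitionLaw
  exact Measure.isProbabilityMeasure_map (by fun_prop)

theorem MDP.ae_isBounded_sampleLaw {S Act : Type*} [MeasurableSpace S]
    [MeasurableSpace Act] (M : MDP S Act) (pol : S → Act) (hpol : Measurable pol)
    (ν : Measure S) [IsProbabilityMeasure ν] {d : ℕ} {φ : S → EuclideanSpace ℝ (Fin d)}
    (hφ : Measurable φ) (hφ_bdd : ∀ s, ‖φ s‖ ≤ 1 / 2)
    (hr_bdd : ∀ s a s', M.reward (s, a, s') (Set.Icc (-1) 1)ᶜ = 0) :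
    ∀ᵐ x ∂(M.sampleLaw pol hpol ν φ), TD.Sample.IsBounded x := by
  have := M.trans_markov
  have := M.reward_markov
  have : IsMarkovKernel (M.chain pol hpol) := by unfold MDP.chain; infer_instance
  have : IsMarkovKernel (M.chainReward pol hpol) := by unfold MDP.chainReward; infer_instance
  have hset : MeasurableSet {x : TD.Sample d | TD.Sample.IsBounded x} := by
    unfold TD.Sample.IsBounded
    exact (((by fun_prop : Measurable fun x : TD.Sample d => ‖x.1‖) measurableSet_Iic).inter
      (((by fun_prop : Measurable fun x : TD.Sample d => ‖x.2.1‖) measurableSet_Iic).inter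
        ((by fun_prop : Measurable fun x : TD.Sample d => |x.2.2|) measurableSet_Iic)))
  unfold MDP.sampleLaw MDP.transitionLaw
  rw [ae_map_iff (by fun_prop) hset]
  have hr : MeasurableSet {x : (S × S) × ℝ | |x.2| ≤ 1} :=
    (by fun_prop : Measurable fun x : (S × S) × ℝ => |x.2|) measurableSet_Iic
  have h1 : ∀ᵐ x ∂((ν ⊗ₘ M.chain pol hpol) ⊗ₘ M.chainReward pol hpol), |x.2| ≤ 1 := by
    rw [Measure.ae_compProd_iff hr]
    refine Filter.Eventually.of_forall fun s => ?_
    rw [MDP.chainReward, Kernel.comap_apply, ae_iff]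
    refine measure_mono_null (fun r hr => ?_) (hr_bdd s.1 (pol s.1) s.2)
    exact fun h => hr (abs_le.2 h)
  exact h1.mono fun x hx => ⟨hφ_bdd _, hφ_bdd _, hx⟩

theorem theorem3 {S Act : Type*} [MeasurableSpace S] [MeasurableSpace Act]
    (M : MDP S Act) (pol : S → Act) (hpol : Measurable pol)
    -- the stationary distribution of the induced chain
    (ν : Measure S) [IsProbabilityMeasure ν] (hν : (M.chain pol hpol).Invariant ν)
    {d : ℕ} (φ : S → EuclideanSpace ℝ (Fin d)) (hφ : Measurable φ)
    -- uniformly bounded features and rewards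
    (hφ_bdd : ∀ s, ‖φ s‖ ≤ 1 / 2)
    (hr_bdd : ∀ s a s', M.reward (s, a, s') (Set.Icc (-1) 1)ᶜ = 0)
    (θ₀ : EuclideanSpace ℝ (Fin d))
    -- `0 < lam < min_i Re λ_i(A)`
    (lam : ℝ) (hlam_pos : 0 < lam)
    (hlam : ∀ z : ℂ,
      Module.End.HasEigenvalue
        (Matrix.toLin' ((TD.A M.γ (M.sampleLaw pol hpol ν φ)).map (algebraMap ℝ ℂ))) z →
      lam < z.re) :
    ∃ (C K : ℝ) (p : ℕ) (N₀ : ℝ → ℕ),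
      (∀ δ : ℝ, 0 < δ → δ < 1 → (N₀ δ : ℝ) ≤ K * Real.log (1 / δ)) ∧
      ∀ (Ω : Type*) [MeasurableSpace Ω] (P : Measure Ω) [IsProbabilityMeasure P]
        (X : ℕ → Ω → EuclideanSpace ℝ (Fin d) × EuclideanSpace ℝ (Fin d) × ℝ),
        (∀ n, HasLaw (X n) (M.sampleLaw pol hpol ν φ) P) → iIndepFun X P →
        ∀ δ : ℝ, 0 < δ → δ < 1 → ∀ n : ℕ, 1 ≤ n → N₀ δ ≤ n →
          1 - δ ≤ P.real {ω |
            ‖TD.iterate M.γ (fun k => 1 / ((k : ℝ) + 1)) θ₀ (fun k => X k ω) n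
                - TD.solution M.γ (M.sampleLaw pol hpol ν φ)‖
              ≤ C * (1 + Real.log n + Real.log (1 / δ)) ^ p
                * (n : ℝ) ^ (-min (1 / 2) (lam / (lam + 1)))} := by
  have hprob := M.isProbabilityMeasure_sampleLaw pol hpol ν hφ
  have hρ := M.ae_isBounded_sampleLaw pol hpol ν hφ hφ_bdd hr_bdd
  set ρ := M.sampleLaw pol hpol ν φ
  rcases subsingleton_or_nontrivial (EuclideanSpace ℝ (Fin d)) with hd | hd
  · -- in dimension `0` all vectors coincide
    refine ⟨0, 0, 0, fun _ => 0, by simp, fun Ω _ P _ X _ _ δ hδ _ n _ _ => ?_⟩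
    have h : ∀ v w : EuclideanSpace ℝ (Fin d), ‖v - w‖ = 0 := fun v w => by
      rw [Subsingleton.elim v w, sub_self, norm_zero]
    simp only [h, zero_mul, le_refl, Set.ofPred_true, probReal_univ]
    linarith
  obtain ⟨N, J, hJ, hlyap⟩ := exists_lyapunov_map (TD.A M.γ ρ) lam hlam
  have hlam1 : lam < 1 := lyapunov_rate_lt_one _
    (TD.norm_toEuclideanCLM_A_le M.γ_pos M.γ_lt_one hρ) J hJ lam hlyap
  -- the Lyapunov inequality excludes a kernel
  have hdet : IsUnit (TD.A M.γ ρ).det := by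
    rw [isUnit_iff_ne_zero]
    intro h0
    obtain ⟨v, hv0, hv⟩ := Matrix.exists_mulVec_eq_zero_iff.2 h0
    have h1 := hlyap (WithLp.toLp 2 v)
    rw [Matrix.toEuclideanCLM_toLp, hv, WithLp.toLp_zero, map_zero, inner_zero_right] at h1
    have h2 : WithLp.toLp 2 v ≠ 0 := fun h => hv0 (by simpa using h)
    have h3 := (norm_pos_iff.2 h2).trans_le (hJ _)
    have h4 := mul_pos hlam_pos (pow_pos h3 2)
    linarith
  -- `lam < 1` makes `1 / 2` irrelevant in the minimum
  have hmin : min (1 / 2) (lam / (lam + 1)) = lam / (lam + 1) := by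
    refine min_eq_right ?_
    rw [div_le_iff₀ (by linarith)]
    linarith
  obtain ⟨C, p, hCp⟩ := TD.exists_tail_bound hρ M.γ_pos M.γ_lt_one J hJ (TD.solution M.γ ρ) θ₀
    (lam := lam) (κ := lam / (lam + 1)) (by positivity)
    (div_le_self hlam_pos.le (by linarith))
    (by rw [← mul_div_assoc, div_lt_one (by linarith)]; linarith)
    (fun θ => by
      rw [TD.integral_increment_eq_neg M.γ_pos M.γ_lt_one hρ hdet, map_neg, inner_neg_right]
      exact neg_le_neg (hlyap _))
  refine ⟨C, 0, p, fun _ => 0, by simp, fun Ω _ P _ X hX hind δ hδ0 hδ1 n hn _ => ?_⟩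
  rw [hmin]
  exact hCp Ω P X hX hind δ hδ0 hδ1 n hn
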